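/- Let $q$ be a prime power and let $\mathbb{F}_q$ be the field with $q$ elements. On $\mathbb{F}_q^6$ consider the hyperbolic quadratic form $Q(x)=x_1x_6+x_2x_5+x_3x_4$ and the associated bilinear form $B(x,y)=\sum_{i=1}^{6}x_iy_{7-i}$. Let $\mathbb{O}_{3,6}$ be the set of all $3$-dimensional subspaces $W\subseteq\mathbb{F}_q^6$ that are totally singular, i.e. $B(v,w)=0$ and $Q(v)=0$ for all $v,w\in W$. For each $W\in\mathbb{O}_{3,6}$ choose a $3\times 6$ matrix $M_W$ over $\mathbb{F}_q$ whose row space is $W$. For $I\subseteq\{1,\dots,6\}$ with $|I|=3$, let $\det_I(\mathbf{X})$ be the $3\times 3$ minor of the generic $3\times 6$ matrix $\mathbf{X}$ on the columns in $I$ (in increasing order), and let $\Delta(3,6)$ be the $\mathbb{F}_q$-linear span of these minors. The polar orthogonal Grassmann code is $$C(\mathbb{O}_{3,6})=\{\,\mathrm{ev}(f) : f\in\Delta(3,6)\,\},\qquad \mathrm{ev}(f)=(f(M_W))_{W\in\mathbb{O}_{3,6}}.$$ Then, for every choice of the representatives $M_W$, the minimum (Hamming) distance of this code is $$d(C(\mathbb{O}_{3,6}))=\begin{cases}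 q^3, & q \text{ even},\\ q^3-q^2, & q\text{ odd}.\end{cases}$$ Moreover, this value is attained by the Hamming weight of the codeword $\mathrm{ev}(\det_{236}+\det_{456})$ if $q$ is odd, and by that of the codeword $\mathrm{ev}(\det_{456})$ if $q$ is even. For $q=2$ the code is a $[30,14,8]_2$ code: it has length $|\mathbb{O}_{3,6}|=30$, dimension $14$ and minimum distance $8$. -/

import Mathlib

/-! Points of `F ^ (2ℓ)` are functions `Fin (2 * ℓ) → F`. Coordinates and columns are numbered from
`0`, so `Fin.rev` is the involution `i ↦ 2ℓ + 1 - i` of the usual numbering from `1`. -/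

namespace OrthogonalGrassmann

/-- The antidiagonal matrix `J`. -/
def antidiag (F : Type*) [Field F] (m : ℕ) : Matrix (Fin m) (Fin m) F :=
  Matrix.of fun i j => if j = i.rev then 1 else 0

/-- The symmetric bilinear form `B(x, y) = x J yᵀ`. -/
def bilin {F : Type*} [Field F] {m : ℕ} (x y : Fin m → F) : F :=
  x ⬝ᵥ ((antidiag F m).mulVec y)

/-- The hyperbolic quadratic form `x₁ x_{2ℓ} + x₂ x_{2ℓ-1} + ⋯ + x_ℓ x_{ℓ+1}`. -/
def quad {F : Type*} [Field F] {ℓ : ℕ} (x : Fin (2 * ℓ) → F) : F :=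
  ∑ i : Fin ℓ, x (Fin.castLE (Nat.le_mul_of_pos_left ℓ two_pos) i) *
    x (Fin.castLE (Nat.le_mul_of_pos_left ℓ two_pos) i).rev

/-- The polar orthogonal Grassmannian: all `ℓ`-dimensional totally singular subspaces of
`F ^ (2ℓ)`. -/
def polarGrassmannian (F : Type*) [Field F] (ℓ : ℕ) : Set (Submodule F (Fin (2 * ℓ) → F)) :=
  {W | Module.finrank F W = ℓ ∧ ∀ v ∈ W, ∀ w ∈ W, bilin v w = 0 ∧ quad v = 0}

noncomputable instance (F : Type*) [Field F] [Finite F] (ℓ : ℕ) :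
    Fintype (polarGrassmannian F ℓ) :=
  Fintype.ofFinite _

/-- `det_I(X)`: the minor, on the columns listed by `I`, of the generic `ℓ × m` matrix `X`, as a
polynomial in the entries of `X`. -/
noncomputable def genericMinor (F : Type*) [Field F] {ℓ m : ℕ} (I : Fin ℓ → Fin m) :
    MvPolynomial (Fin ℓ × Fin m) F :=
  ((Matrix.mvPolynomialX (Fin ℓ) (Fin m) F).submatrix id I).det

/-- `Δ(ℓ, m)`: all linear combinations of the `ℓ × ℓ` minors `det_I(X)`, where `I` runs over the
`ℓ`-element sets of columns, each listed in increasing order. -/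
noncomputable def minorSpace (F : Type*) [Field F] (ℓ m : ℕ) :
    Submodule F (MvPolynomial (Fin ℓ × Fin m) F) :=
  Submodule.span F {p | ∃ I : Fin ℓ → Fin m, StrictMono I ∧ p = genericMinor F I}

/-- `M` picks one matrix representative for each point of the polar orthogonal Grassmannian: the
row space of `M W` is `W`. -/
def IsRepresentatives {F : Type*} [Field F] {ℓ : ℕ}
    (M : polarGrassmannian F ℓ → Matrix (Fin ℓ) (Fin (2 * ℓ)) F) : Prop :=
  ∀ W, Submodule.span F (Set.range (M W).row) = (W : Submodule F (Fin (2 * ℓ) → F))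

/-- Representatives exist. -/
theorem exists_isRepresentatives (F : Type*) [Field F] (ℓ : ℕ) :
    ∃ M : polarGrassmannian F ℓ → Matrix (Fin ℓ) (Fin (2 * ℓ)) F, IsRepresentatives M := by
  have h : ∀ W : polarGrassmannian F ℓ, ∃ A : Matrix (Fin ℓ) (Fin (2 * ℓ)) F,
      Submodule.span F (Set.range A.row) = (W : Submodule F (Fin (2 * ℓ) → F)) := by
    intro W
    let b := Module.finBasisOfFinrankEq F (W : Submodule F (Fin (2 * ℓ) → F)) W.2.1
    refine ⟨Matrix.of fun i => (b i : Fin (2 * ℓ) → F), ?_⟩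
    have h1 : Set.range (Matrix.of fun i => (b i : Fin (2 * ℓ) → F)).row =
        (W : Submodule F (Fin (2 * ℓ) → F)).subtype '' Set.range b := by
      rw [← Set.range_comp]; rfl
    rw [h1, ← Submodule.map_span, b.span_eq, Submodule.map_subtype_top]
  choose M hM using h
  exact ⟨M, hM⟩

/-- The evaluation map `f ↦ (f(M_W))_W`. -/
noncomputable def ev {F : Type*} [Field F] {ι : Type*} {ℓ m : ℕ}
    (M : ι → Matrix (Fin ℓ) (Fin m) F) :
    MvPolynomial (Fin ℓ × Fin m) F →ₗ[F] (ι → F) :=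
  LinearMap.pi fun W => (MvPolynomial.aeval fun p => M W p.1 p.2).toLinearMap

/-- The polar orthogonal Grassmann code, the image of `Δ(ℓ, 2ℓ)` under evaluation. Its coordinates
are indexed by the points of the polar orthogonal Grassmannian. -/
noncomputable def polarCode {F : Type*} [Field F] {ℓ : ℕ}
    (M : polarGrassmannian F ℓ → Matrix (Fin ℓ) (Fin (2 * ℓ)) F) :
    Submodule F (polarGrassmannian F ℓ → F) :=
  (minorSpace F ℓ (2 * ℓ)).map (ev M)

/-- `d` is the minimum distance of the linear code `C`: the least Hamming distance between two
distinct codewords. -/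
def IsMinDist {F ι : Type*} [Field F] [DecidableEq F] [Fintype ι]
    (C : Submodule F (ι → F)) (d : ℕ) : Prop :=
  IsLeast {k | ∃ c ∈ C, ∃ c' ∈ C, c ≠ c' ∧ hammingDist c c' = k} d

end OrthogonalGrassmann

namespace OrthogonalGrassmann

open Finset

/-! The proof uses the coincidence D₃ = A₃. The singular 3-spaces of the Klein quadric form two
families, each in bijection with the points of PG(3, q): a nonzero half-spinor `x` in `F ^ 4`
corresponds to the space `annih ε x` of vectors whose Clifford action kills it
(`pureSpace_surjective`, `pureSpace_eq_iff`). In this parametrisation all maximal minors are, up to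
a common nonzero factor, quadratic forms in `x` (`minorComb_chart`). A codeword is thus a pair of
quadratic forms on `F ^ 4`, and `q - 1` times its weight is the total number of their nonzeros
(`hammingNorm_word`).

A nonzero quadratic form on `F ^ 4` has at least `q ^ 2 * (q - 1) ^ 2` nonzeros (`card_nonzero_ge`),
so every nonzero codeword has weight at least `q ^ 3 - q ^ 2`. For odd `q` equality holds when one
form is zero and the other is a product of two independent linear forms.

In characteristic 2 the two forms share their six mixed coefficients. If one form vanishes, the
other is a sum of squares, hence additive, with at least `q ^ 4 - q ^ 3` nonzeros
(`polar_spinForm_eq_zero`). If neither vanishes, the weight is at least `2 * q ^ 2 * (q - 1)`, which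
is at least `q ^ 3`. The dimension 14 counts eight square coefficients and six shared mixed ones. -/

theorem card_nonzero_of_bilinear_pencil {F : Type*} [Field F] [Fintype F] [DecidableEq F]
    (a m n b : F) (hb : b ≠ 0) :
    (Fintype.card F - 1) ^ 2 ≤
      #{p : F × F | a + p.1 * m + p.2 * n + p.1 * p.2 * b ≠ 0} := by
  -- For fixed `s` the expression is affine in `t` with slope `n + s * b`, which vanishes for a
  -- single `s`.
  have key : ∀ s : F, n + s * b ≠ 0 →
      Fintype.card F - 1 ≤ #{t : F | a + s * m + t * n + s * t * b ≠ 0} := by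
    intro s hs
    have h1 : (univ.erase (-(a + s * m) / (n + s * b))) ⊆
        ({t : F | a + s * m + t * n + s * t * b ≠ 0} : Finset F) := by
      intro t ht
      simp only [mem_erase, mem_univ, and_true] at ht
      simp only [mem_filter, mem_univ, true_and]
      intro h
      apply ht
      rw [eq_div_iff hs]
      linear_combination h
    have h2 := card_le_card h1
    rwa [card_erase_of_mem (mem_univ _), card_univ] at h2
  have h3 : #{p : F × F | a + p.1 * m + p.2 * n + p.1 * p.2 * b ≠ 0} =
      ∑ s : F, #{t : F | a + s * m + t * n + s * t * b ≠ 0} := by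
    simp only [card_filter]
    rw [Fintype.sum_prod_type]
  rw [h3]
  calc (Fintype.card F - 1) ^ 2
      = ∑ s ∈ univ.erase (-n / b), (Fintype.card F - 1) := by
        rw [sum_const, card_erase_of_mem (mem_univ _), card_univ, smul_eq_mul, sq]
    _ ≤ ∑ s ∈ univ.erase (-n / b), #{t : F | a + s * m + t * n + s * t * b ≠ 0} := by
        apply sum_le_sum
        intro s hs
        apply key
        simp only [mem_erase, mem_univ, and_true] at hs
        intro h
        apply hs
        rw [eq_div_iff hb]
        linear_combination h
    _ ≤ _ := sum_le_sum_of_subset (erase_subset _ _)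

/-! ### Counting the nonzeros of a quadratic form. -/

section QuadraticForm

variable {F V : Type*} [Field F] [Fintype F] [DecidableEq F] [AddCommGroup V] [Module F V]
  [Fintype V]

/-- A quadratic form with a hyperbolic pair has at least as many nonzeros as a hyperbolic
quadric. -/
theorem card_nonzero_of_hyperbolicPair (P : QuadraticForm F V) {u v : V}
    (hu : P u = 0) (hv : P v = 0) (huv : QuadraticMap.polar P u v ≠ 0) :
    Fintype.card V * (Fintype.card F - 1) ^ 2 ≤ Fintype.card F ^ 2 * #{x : V | P x ≠ 0} := by
  have expand : ∀ (w : V) (p : F × F), P (w + (p.1 • u + p.2 • v)) =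
      P w + p.1 * QuadraticMap.polar P w u + p.2 * QuadraticMap.polar P w v +
        p.1 * p.2 * QuadraticMap.polar P u v := by
    intro w p
    rw [QuadraticMap.map_add P w, QuadraticMap.map_add P (p.1 • u), QuadraticMap.map_smul,
      QuadraticMap.map_smul, QuadraticMap.polar_add_right, QuadraticMap.polar_smul_right,
      QuadraticMap.polar_smul_right, QuadraticMap.polar_smul_left, QuadraticMap.polar_smul_right,
      hu, hv]
    simp only [smul_eq_mul]
    ring
  calc Fintype.card V * (Fintype.card F - 1) ^ 2
      = ∑ _w : V, (Fintype.card F - 1) ^ 2 := by simp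
    -- Each translate of the plane of `u` and `v` carries a bilinear pencil; summing over all `w`
    -- counts every vector `q ^ 2` times.
    _ ≤ ∑ w : V, #{p : F × F | P (w + (p.1 • u + p.2 • v)) ≠ 0} := by
        apply sum_le_sum
        intro w _
        simp only [expand]
        exact card_nonzero_of_bilinear_pencil _ _ _ _ huv
    _ = ∑ p : F × F, #{w : V | P (w + (p.1 • u + p.2 • v)) ≠ 0} := by
        simp only [card_filter]
        exact sum_comm
    _ = ∑ _p : F × F, #{x : V | P x ≠ 0} := by
        apply sum_congr rfl
        intro p _
        simp only [card_filter]
        exact Fintype.sum_equiv (Equiv.addRight (p.1 • u + p.2 • v)) _ _ (fun w => rfl)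
    _ = _ := by simp [sq]

/-- If the singular vectors of a nonzero quadratic form are pairwise orthogonal, they form a
proper subspace. -/
theorem card_nonzero_of_orthogonal (P : QuadraticForm F V) (hP : P ≠ 0)
    (h : ∀ u v, P u = 0 → P v = 0 → QuadraticMap.polar P u v = 0) :
    Fintype.card V * (Fintype.card F - 1) ≤ Fintype.card F * #{x : V | P x ≠ 0} := by
  classical
  let Z : Submodule F V :=
    { carrier := {x | P x = 0}
      zero_mem' := by simp
      add_mem' := by
        intro a b (ha : P a = 0) (hb : P b = 0)
        change P (a + b) = 0
        rw [QuadraticMap.map_add P, ha, hb, h a b ha hb]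
        simp
      smul_mem' := by
        intro c a (ha : P a = 0)
        change P (c • a) = 0
        rw [QuadraticMap.map_smul, ha, smul_zero] }
  have hZ : Z ≠ ⊤ := by
    intro hZ
    apply hP
    ext x
    have : x ∈ Z := hZ ▸ Submodule.mem_top
    exact this
  have hlt := Submodule.finrank_lt hZ
  have hcV : Fintype.card V = Fintype.card F ^ Module.finrank F V := Module.card_eq_pow_finrank
  have hcZ : Fintype.card Z = Fintype.card F ^ Module.finrank F Z := Module.card_eq_pow_finrank
  have hq : 0 < Fintype.card F := Fintype.card_pos
  have h1 : Fintype.card F * Fintype.card Z ≤ Fintype.card V := by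
    rw [hcV, hcZ, mul_comm, ← pow_succ]
    exact Nat.pow_le_pow_right hq hlt
  have h2 : Fintype.card Z = #{x : V | P x = 0} :=
    Fintype.card_of_subtype _ fun x => by simp [Z]
  have h3 : #{x : V | P x = 0} + #{x : V | P x ≠ 0} = Fintype.card V :=
    card_filter_add_card_filter_not _
  rw [h2] at h1
  rw [← h3] at h1 ⊢
  rw [Nat.mul_sub, mul_one, tsub_le_iff_right]
  nlinarith

/-- Either two singular vectors are not orthogonal and form a hyperbolic pair, or the singular
vectors form a proper subspace, which gives an even stronger bound. -/
theorem card_nonzero_ge (P : QuadraticForm F V) (hP : P ≠ 0) :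
    Fintype.card V * (Fintype.card F - 1) ^ 2 ≤ Fintype.card F ^ 2 * #{x : V | P x ≠ 0} := by
  by_cases h : ∀ u v, P u = 0 → P v = 0 → QuadraticMap.polar P u v = 0
  · calc Fintype.card V * (Fintype.card F - 1) ^ 2
        = (Fintype.card V * (Fintype.card F - 1)) * (Fintype.card F - 1) := by ring
      _ ≤ (Fintype.card F * #{x : V | P x ≠ 0}) * Fintype.card F :=
          Nat.mul_le_mul (card_nonzero_of_orthogonal P hP h) (Nat.sub_le _ _)
      _ = _ := by ring
  · push Not at h
    obtain ⟨u, v, hu, hv, huv⟩ := h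
    exact card_nonzero_of_hyperbolicPair P hu hv huv

end QuadraticForm

/-! ### The Clifford module of the Klein quadric and its half-spinors. -/

section Skew

variable {F : Type*} [Field F]

/-- The skew-symmetric `4 × 4` matrix with Plücker coordinates `z`. Its Pfaffian is `quad z`. -/
def skew (z : Fin (2 * 3) → F) : Matrix (Fin 4) (Fin 4) F :=
  !![0, z 0, z 1, z 2; -z 0, 0, z 3, -z 4; -z 1, -z 3, 0, z 5; -z 2, z 4, -z 5, 0]

/-- The two half-spin representations: the Plücker matrix and its dual. -/
def halfSpin : Bool → (Fin (2 * 3) → F) →ₗ[F] Matrix (Fin 4) (Fin 4) F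
  | true =>
    { toFun := skew
      map_add' := by
        intro a b
        ext i j
        fin_cases i <;> fin_cases j <;> simp [skew] <;> ring
      map_smul' := by
        intro a b
        ext i j
        fin_cases i <;> fin_cases j <;> simp [skew] }
  | false =>
    { toFun := fun z => skew (z ∘ Fin.rev)
      map_add' := by
        intro a b
        ext i j
        fin_cases i <;> fin_cases j <;> simp [skew] <;> ring
      map_smul' := by
        intro a b
        ext i j
        fin_cases i <;> fin_cases j <;> simp [skew] }

theorem quad_eq (z : Fin (2 * 3) → F) : quad z = z 0 * z 5 + z 1 * z 4 + z 2 * z 3 := by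
  rw [quad, Fin.sum_univ_three]
  rfl

theorem bilin_eq_sum {m : ℕ} (x y : Fin m → F) : bilin x y = ∑ i, x i * y i.rev := by
  simp [bilin, antidiag, dotProduct, Matrix.mulVec]

theorem bilin_eq (x y : Fin (2 * 3) → F) :
    bilin x y = x 0 * y 5 + x 1 * y 4 + x 2 * y 3 + x 3 * y 2 + x 4 * y 1 + x 5 * y 0 := by
  rw [bilin_eq_sum]
  exact Fin.sum_univ_six (fun i : Fin 6 => x i * y i.rev)

theorem quad_add (x y : Fin (2 * 3) → F) : quad (x + y) = quad x + quad y + bilin x y := by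
  simp only [quad_eq, bilin_eq, Pi.add_apply]
  ring

theorem halfSpin_true (z : Fin (2 * 3) → F) : halfSpin true z =
    !![0, z 0, z 1, z 2; -z 0, 0, z 3, -z 4; -z 1, -z 3, 0, z 5; -z 2, z 4, -z 5, 0] := rfl

theorem halfSpin_false (z : Fin (2 * 3) → F) : halfSpin false z =
    !![0, z 5, z 4, z 3; -z 5, 0, z 2, -z 1; -z 4, -z 2, 0, z 0; -z 3, z 1, -z 0, 0] := rfl

/-- A skew 4 × 4 matrix times its dual is the Pfaffian up to sign. This is the Clifford relation on
each half-spin space. -/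
theorem halfSpin_mul_halfSpin_not (ε : Bool) (z : Fin (2 * 3) → F) :
    halfSpin ε z * halfSpin (!ε) z = (-quad z) • (1 : Matrix (Fin 4) (Fin 4) F) := by
  rw [quad_eq]
  cases ε <;> simp only [Bool.not_true, Bool.not_false, halfSpin_true, halfSpin_false] <;>
    ext i j <;> fin_cases i <;> fin_cases j <;>
    simp [-Nat.reduceMul, Matrix.mul_apply, Fin.sum_univ_four] <;> ring

/-- The Clifford multiplication by `z` on the space of spinors. -/
def clifford : (Fin (2 * 3) → F) →ₗ[F] Matrix (Fin 4 ⊕ Fin 4) (Fin 4 ⊕ Fin 4) F where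
  toFun z := Matrix.fromBlocks 0 (halfSpin true z) (halfSpin false z) 0
  map_add' a b := by simp [Matrix.fromBlocks_add]
  map_smul' a b := by simp [Matrix.fromBlocks_smul]

theorem clifford_mul_self (z : Fin (2 * 3) → F) :
    clifford z * clifford z = (-quad z) • (1 : Matrix (Fin 4 ⊕ Fin 4) (Fin 4 ⊕ Fin 4) F) := by
  have h1 := halfSpin_mul_halfSpin_not true z
  have h2 := halfSpin_mul_halfSpin_not false z
  simp only [Bool.not_true, Bool.not_false] at h1 h2
  change Matrix.fromBlocks _ _ _ _ * Matrix.fromBlocks _ _ _ _ = _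
  rw [Matrix.fromBlocks_multiply, h1, h2, ← Matrix.fromBlocks_one, Matrix.fromBlocks_smul]
  simp

theorem clifford_anticomm (z w : Fin (2 * 3) → F) :
    clifford z * clifford w + clifford w * clifford z =
      (-bilin z w) • (1 : Matrix (Fin 4 ⊕ Fin 4) (Fin 4 ⊕ Fin 4) F) := by
  have h := clifford_mul_self (z + w)
  rw [map_add, add_mul, mul_add, mul_add, clifford_mul_self, clifford_mul_self, quad_add] at h
  have h' : clifford z * clifford w + clifford w * clifford z =
      (-(quad z + quad w + bilin z w)) • (1 : Matrix (Fin 4 ⊕ Fin 4) (Fin 4 ⊕ Fin 4) F)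
        - (-quad z) • (1 : Matrix (Fin 4 ⊕ Fin 4) (Fin 4 ⊕ Fin 4) F)
        - (-quad w) • (1 : Matrix (Fin 4 ⊕ Fin 4) (Fin 4 ⊕ Fin 4) F) := by
    rw [← h]; abel
  rw [h', ← sub_smul, ← sub_smul]
  congr 1
  ring

/-- A linearly independent family has a dual family with respect to `bilin`. -/
theorem exists_bilin_dual {ι : Type*} [Fintype ι] [DecidableEq ι] {m : ℕ} {z : ι → Fin m → F}
    (hz : LinearIndependent F z) :
    ∃ u : ι → Fin m → F, ∀ i j, bilin (z i) (u j) = if i = j then 1 else 0 := by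
  have hinj : LinearMap.ker (Fintype.linearCombination F z) = ⊥ :=
    LinearMap.ker_eq_bot.mpr (hz.fintypeLinearCombination_injective)
  obtain ⟨g, hg⟩ := LinearMap.exists_leftInverse_of_injective _ hinj
  refine ⟨fun j k => g (Pi.single k.rev 1) j, fun i j => ?_⟩
  have h1 : g (z i) = Pi.single i 1 := by
    have := LinearMap.congr_fun hg (Pi.single i 1)
    simpa [Fintype.linearCombination_apply_single] using this
  have h2 : bilin (z i) (fun k => g (Pi.single k.rev 1) j) = g (z i) j := by
    conv_rhs => rw [LinearMap.pi_apply_eq_sum_univ g (z i)]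
    rw [bilin_eq_sum, Finset.sum_apply]
    refine Finset.sum_congr rfl fun k _ => ?_
    have : (fun j => if k = j then (1 : F) else 0) = Pi.single k 1 := by
      ext j; simp [Pi.single_apply, eq_comm]
    simp [this]
  rw [h2, h1]
  simp [Pi.single_apply, eq_comm]

/-- The Clifford product of a basis of a totally singular space does not vanish. -/
theorem clifford_prod_ne_zero {z : Fin 3 → Fin (2 * 3) → F} (hz : LinearIndependent F z) :
    clifford (z 0) * clifford (z 1) * clifford (z 2) ≠ 0 := by
  obtain ⟨u, hu⟩ := exists_bilin_dual hz
  -- The dual vector `u j` anticommutes with every `z i` except `z j`, where a scalar remains, so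
  -- multiplying by it acts as a contraction.
  have rel : ∀ i j, clifford (u j) * clifford (z i) =
      -(clifford (z i) * clifford (u j)) -
        (if i = j then (1 : Matrix (Fin 4 ⊕ Fin 4) (Fin 4 ⊕ Fin 4) F) else 0) := by
    intro i j
    have h := clifford_anticomm (z i) (u j)
    rw [hu] at h
    rw [eq_sub_iff_add_eq, eq_neg_iff_add_eq_zero]
    by_cases hij : i = j
    · simp only [hij, if_true, neg_smul, one_smul] at h ⊢
      rw [← neg_add_cancel (1 : Matrix (Fin 4 ⊕ Fin 4) (Fin 4 ⊕ Fin 4) F), ← h]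
      abel
    · simp only [hij, if_false, neg_zero, zero_smul, add_zero] at h ⊢
      rw [← h]; abel
  have r00 := rel 0 0
  have r10 := rel 1 0
  have r20 := rel 2 0
  have r11 := rel 1 1
  have r21 := rel 2 1
  have r22 := rel 2 2
  simp only [Fin.reduceEq, if_true, if_false, sub_zero] at r00 r10 r20 r11 r21 r22
  intro h
  -- Moving `u 0` through the product strips off the factor `z 0`, so vanishing passes to the
  -- shorter product; iterating leads to `0 = -1`.
  have h2 : clifford (z 1) * clifford (z 2) = 0 := by
    have e : clifford (u 0) * (clifford (z 0) * clifford (z 1) * clifford (z 2)) =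
        -(clifford (z 0) * clifford (z 1) * clifford (z 2)) * clifford (u 0)
          - clifford (z 1) * clifford (z 2) := by
      rw [← mul_assoc, ← mul_assoc, r00, sub_mul, sub_mul, one_mul, neg_mul, neg_mul,
        mul_assoc (clifford (z 0)) (clifford (u 0)), r10, mul_neg, neg_mul, mul_assoc (clifford (z 0)),
        mul_assoc (clifford (z 1)), r20]
      noncomm_ring
    rw [h] at e
    simpa using e
  have h3 : clifford (z 2) = 0 := by
    have e : clifford (u 1) * (clifford (z 1) * clifford (z 2)) =
        (clifford (z 1) * clifford (z 2)) * clifford (u 1) - clifford (z 2) := by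
      rw [← mul_assoc, r11, sub_mul, one_mul, neg_mul, mul_assoc (clifford (z 1)), r21]
      noncomm_ring
    rw [h2] at e
    simpa using e
  rw [h3] at r22
  simp at r22

/-- The vectors of `F ^ 6` whose half-spin matrix annihilates `x`. -/
def annih (ε : Bool) (x : Fin 4 → F) : Submodule F (Fin (2 * 3) → F) :=
  LinearMap.ker ((Matrix.mulVecBilin F F).flip x ∘ₗ halfSpin ε)

theorem mem_annih {ε : Bool} {x : Fin 4 → F} {z : Fin (2 * 3) → F} :
    z ∈ annih ε x ↔ (halfSpin ε z).mulVec x = 0 := by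
  simp [annih]

/-- Every totally singular `3`-space annihilates a nonzero half-spinor. -/
theorem exists_le_annih {W : Submodule F (Fin (2 * 3) → F)} (hW : W ∈ polarGrassmannian F 3) :
    ∃ ε : Bool, ∃ x : Fin 4 → F, x ≠ 0 ∧ W ≤ annih ε x := by
  obtain ⟨hdim, hsing⟩ := hW
  let b := Module.finBasisOfFinrankEq F W hdim
  have hb : LinearIndependent F fun i => (b i : Fin (2 * 3) → F) :=
    b.linearIndependent.map' W.subtype (Submodule.ker_subtype W)
  have hne := clifford_prod_ne_zero hb
  set N := clifford (b 0 : Fin (2 * 3) → F) * clifford (b 1 : Fin (2 * 3) → F) *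
    clifford (b 2 : Fin (2 * 3) → F) with hN
  have sq : ∀ i, clifford (b i : Fin (2 * 3) → F) * clifford (b i : Fin (2 * 3) → F) = 0 := by
    intro i
    rw [clifford_mul_self, (hsing _ (b i).2 _ (b i).2).2]
    simp
  have anti : ∀ i j, clifford (b i : Fin (2 * 3) → F) * clifford (b j : Fin (2 * 3) → F) =
      -(clifford (b j : Fin (2 * 3) → F) * clifford (b i : Fin (2 * 3) → F)) := by
    intro i j
    rw [eq_neg_iff_add_eq_zero, clifford_anticomm, (hsing _ (b i).2 _ (b j).2).1]
    simp
  -- Up to sign `b i` can be moved next to its own copy in `N`, and its square is zero.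
  have kill : ∀ i, clifford (b i : Fin (2 * 3) → F) * N = 0 := by
    intro i
    fin_cases i
    · simp only [hN, ← mul_assoc]
      simp [sq]
    · simp only [hN, ← mul_assoc]
      simp [anti 1 0, mul_assoc, sq]
    · simp only [hN, ← mul_assoc]
      simp [anti 2 0, mul_assoc]
      simp [← mul_assoc (clifford (b 2 : Fin (2 * 3) → F)), anti 2 1]
      simp [mul_assoc, sq]
  have killW : ∀ z ∈ W, clifford z * N = 0 := by
    intro z hz
    have h' : z = ∑ i, (b.repr ⟨z, hz⟩) i • (b i : Fin (2 * 3) → F) := by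
      conv_lhs => rw [← Submodule.coe_mk z hz, ← b.sum_repr ⟨z, hz⟩]
      rw [AddSubmonoidClass.coe_finsetSum]
      rfl
    rw [h', map_sum, Finset.sum_mul]
    refine Finset.sum_eq_zero fun i _ => ?_
    rw [map_smul, smul_mul_assoc, kill, smul_zero]
  -- Every column of `N` is a spinor killed by `W`. The block containing a nonzero entry decides
  -- which half-spinor, and hence which family, is used.
  obtain ⟨i, j, hij⟩ : ∃ i j, N i j ≠ 0 := by
    by_contra! h
    exact hne (Matrix.ext h)
  have hcol : ∀ z ∈ W, (clifford z).mulVec (N.col j) = 0 := by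
    intro z hz
    ext k
    exact congrFun (congrFun (killW z hz) k) j
  have hsplit : ∀ z : Fin (2 * 3) → F, clifford z = Matrix.fromBlocks 0 (halfSpin true z) (halfSpin false z) 0 :=
    fun z => rfl
  rcases i with i | i
  · refine ⟨false, N.col j ∘ Sum.inl, fun h => hij (congrFun h i), fun z hz => ?_⟩
    rw [mem_annih]
    have h := hcol z hz
    rw [hsplit, Matrix.fromBlocks_mulVec] at h
    ext k
    simpa using congrFun h (Sum.inr k)
  · refine ⟨true, N.col j ∘ Sum.inr, fun h => hij (congrFun h i), fun z hz => ?_⟩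
    rw [mem_annih]
    have h := hcol z hz
    rw [hsplit, Matrix.fromBlocks_mulVec] at h
    ext k
    simpa using congrFun h (Sum.inl k)

end Skew

/-! ### Parametrisation of the two families by PG(3, q). -/

section Charts

variable {F : Type*} [Field F]

/-- The Plücker coordinates of `x ∧ v`, in the order adapted to the half-spin representation. -/
def wedge : Bool → (Fin 4 → F) → (Fin 4 → F) →ₗ[F] (Fin (2 * 3) → F)
  | true, x =>
    { toFun := fun v => ![x 2 * v 3 - x 3 * v 2, -(x 1 * v 3 - x 3 * v 1), x 1 * v 2 - x 2 * v 1,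
        x 0 * v 3 - x 3 * v 0, x 0 * v 2 - x 2 * v 0, x 0 * v 1 - x 1 * v 0]
      map_add' := by
        intro a b
        ext k
        fin_cases k <;> simp <;> ring
      map_smul' := by
        intro a b
        ext k
        fin_cases k <;> simp <;> ring }
  | false, x =>
    { toFun := fun v => ![x 0 * v 1 - x 1 * v 0, x 0 * v 2 - x 2 * v 0, x 0 * v 3 - x 3 * v 0,
        x 1 * v 2 - x 2 * v 1, -(x 1 * v 3 - x 3 * v 1), x 2 * v 3 - x 3 * v 2]
      map_add' := by
        intro a b
        ext k
        fin_cases k <;> simp <;> ring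
      map_smul' := by
        intro a b
        ext k
        fin_cases k <;> simp <;> ring }

theorem wedge_true (x v : Fin 4 → F) : wedge true x v =
    ![x 2 * v 3 - x 3 * v 2, -(x 1 * v 3 - x 3 * v 1), x 1 * v 2 - x 2 * v 1,
        x 0 * v 3 - x 3 * v 0, x 0 * v 2 - x 2 * v 0, x 0 * v 1 - x 1 * v 0] := rfl

theorem wedge_false (x v : Fin 4 → F) : wedge false x v =
    ![x 0 * v 1 - x 1 * v 0, x 0 * v 2 - x 2 * v 0, x 0 * v 3 - x 3 * v 0,
        x 1 * v 2 - x 2 * v 1, -(x 1 * v 3 - x 3 * v 1), x 2 * v 3 - x 3 * v 2] := rfl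

theorem mem_annih_true {x : Fin 4 → F} {z : Fin (2 * 3) → F} : z ∈ annih true x ↔
    (z 0 * x 1 + z 1 * x 2 + z 2 * x 3 = 0 ∧ -z 0 * x 0 + z 3 * x 2 - z 4 * x 3 = 0 ∧
      -z 1 * x 0 - z 3 * x 1 + z 5 * x 3 = 0 ∧ -z 2 * x 0 + z 4 * x 1 - z 5 * x 2 = 0) := by
  rw [mem_annih, halfSpin_true, funext_iff, Fin.forall_fin_succ, Fin.forall_fin_succ,
    Fin.forall_fin_succ, Fin.forall_fin_succ]
  simp [Matrix.mulVec, dotProduct, Fin.sum_univ_four, sub_eq_add_neg]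

theorem mem_annih_false {x : Fin 4 → F} {z : Fin (2 * 3) → F} : z ∈ annih false x ↔
    (z 5 * x 1 + z 4 * x 2 + z 3 * x 3 = 0 ∧ -z 5 * x 0 + z 2 * x 2 - z 1 * x 3 = 0 ∧
      -z 4 * x 0 - z 2 * x 1 + z 0 * x 3 = 0 ∧ -z 3 * x 0 + z 1 * x 1 - z 0 * x 2 = 0) := by
  rw [mem_annih, halfSpin_false, funext_iff, Fin.forall_fin_succ, Fin.forall_fin_succ,
    Fin.forall_fin_succ, Fin.forall_fin_succ]
  simp [Matrix.mulVec, dotProduct, Fin.sum_univ_four, sub_eq_add_neg]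

theorem wedge_mem_annih (ε : Bool) (x v : Fin 4 → F) : wedge ε x v ∈ annih ε x := by
  cases ε
  · rw [mem_annih_false, wedge_false]
    refine ⟨?_, ?_, ?_, ?_⟩ <;> simp <;> ring
  · rw [mem_annih_true, wedge_true]
    refine ⟨?_, ?_, ?_, ?_⟩ <;> simp <;> ring

/-- Killing `x` forces the dual bivector to have the form `x ∧ v`. Its row `i` is `x i • v - v i •
x`, and wedging this with `x` returns `x i • (x ∧ v)`. -/
theorem smul_eq_wedge {ε : Bool} {x : Fin 4 → F} {z : Fin (2 * 3) → F} (hz : z ∈ annih ε x)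
    (i : Fin 4) : x i • z = wedge ε x (halfSpin (!ε) z i) := by
  cases ε
  · rw [mem_annih_false] at hz
    obtain ⟨h0, h1, h2, h3⟩ := hz
    rw [wedge_false, Bool.not_false, halfSpin_true]
    ext k
    fin_cases i <;> fin_cases k <;> simp <;> grind
  · rw [mem_annih_true] at hz
    obtain ⟨h0, h1, h2, h3⟩ := hz
    rw [wedge_true, Bool.not_true, halfSpin_false]
    ext k
    fin_cases i <;> fin_cases k <;> simp <;> grind

/-- Three vectors spanning `annih ε x` when `x i ≠ 0`. -/
def chart (ε : Bool) (x : Fin 4 → F) (i : Fin 4) : Matrix (Fin 3) (Fin (2 * 3)) F :=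
  Matrix.of fun r => wedge ε x (Pi.single (i.succAbove r) 1)

theorem annih_eq_span (ε : Bool) {x : Fin 4 → F} {i : Fin 4} (hi : x i ≠ 0) :
    annih ε x = Submodule.span F (Set.range (chart ε x i).row) := by
  apply le_antisymm
  · intro z hz
    have h := smul_eq_wedge hz i
    -- The zero diagonal removes the basis vector of index `i`, leaving exactly the three rows of
    -- the chart.
    have hdiag : halfSpin (!ε) z i i = 0 := by
      cases ε <;> fin_cases i <;> rfl
    have hz' : z = (x i)⁻¹ • wedge ε x (halfSpin (!ε) z i) := by
      rw [← h, smul_smul, inv_mul_cancel₀ hi, one_smul]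
    rw [hz']
    refine Submodule.smul_mem _ _ ?_
    rw [LinearMap.pi_apply_eq_sum_univ (wedge ε x), Fin.sum_univ_succAbove _ i, hdiag, zero_smul,
      zero_add]
    refine Submodule.sum_mem _ fun r _ => Submodule.smul_mem _ _ (Submodule.subset_span ⟨r, ?_⟩)
    change wedge ε x (Pi.single (i.succAbove r) 1) = _
    congr 1
    ext j
    simp [Pi.single_apply, eq_comm]
  · rw [Submodule.span_le]
    rintro _ ⟨r, rfl⟩
    exact wedge_mem_annih ε x _

/-! ### Minors as quadratic forms in the half-spinor. -/

/-- The increasing triples of columns in lexicographic order. -/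
def triples : Fin 20 → Fin 3 → Fin (2 * 3) :=
  ![![0, 1, 2], ![0, 1, 3], ![0, 1, 4], ![0, 1, 5], ![0, 2, 3], ![0, 2, 4], ![0, 2, 5],
    ![0, 3, 4], ![0, 3, 5], ![0, 4, 5], ![1, 2, 3], ![1, 2, 4], ![1, 2, 5], ![1, 3, 4],
    ![1, 3, 5], ![1, 4, 5], ![2, 3, 4], ![2, 3, 5], ![2, 4, 5], ![3, 4, 5]]

theorem sum_univ_twenty {A : Type*} [AddCommMonoid A] (f : Fin 20 → A) :
    ∑ k, f k = f 0 + f 1 + f 2 + f 3 + f 4 + f 5 + f 6 + f 7 + f 8 + f 9 + f 10 + f 11 + f 12 +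
      f 13 + f 14 + f 15 + f 16 + f 17 + f 18 + f 19 := by
  simp only [Fin.sum_univ_castSucc, Finset.univ_eq_empty, Finset.sum_empty, zero_add]
  rfl

/-- The linear combination of the maximal minors of `A` with coefficients `c`. -/
def minorComb (c : Fin 20 → F) (A : Matrix (Fin 3) (Fin (2 * 3)) F) : F :=
  ∑ k, c k * (A.submatrix id (triples k)).det

theorem minorComb_mul (c : Fin 20 → F) (G : Matrix (Fin 3) (Fin 3) F)
    (A : Matrix (Fin 3) (Fin (2 * 3)) F) : minorComb c (G * A) = G.det * minorComb c A := by
  simp only [minorComb, Finset.mul_sum]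
  refine Finset.sum_congr rfl fun k _ => ?_
  rw [Matrix.submatrix_mul G A id id (triples k) Function.bijective_id, Matrix.det_mul,
    Matrix.submatrix_id_id]
  ring

/-- The coefficients of the quadratic form of spinors attached to `c`: those of the squares, then
those of the mixed terms. -/
def spinCoeff : Bool → (Fin 20 → F) → Fin 10 → F
  | true, c => ![-c 19, c 12, -c 5, c 1, c 15 + c 17, -c 9 + c 16, -c 8 - c 13, -c 6 + c 11,
      c 3 + c 10, c 2 - c 4]
  | false, c => ![c 0, -c 7, c 14, -c 18, -c 2 - c 4, c 3 - c 10, c 6 + c 11, c 8 - c 13,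
      -c 9 - c 16, -c 15 + c 17]

/-- The monomial quadratic form `x i * x j`. -/
def monomialForm (i j : Fin 4) : QuadraticForm F (Fin 4 → F) :=
  QuadraticMap.linMulLin (LinearMap.proj i) (LinearMap.proj j)

/-- The quadratic form on half-spinors attached to a linear combination of minors. -/
def spinForm (ε : Bool) (c : Fin 20 → F) : QuadraticForm F (Fin 4 → F) :=
  spinCoeff ε c 0 • monomialForm 0 0 + spinCoeff ε c 1 • monomialForm 1 1 +
  spinCoeff ε c 2 • monomialForm 2 2 + spinCoeff ε c 3 • monomialForm 3 3 +
  spinCoeff ε c 4 • monomialForm 0 1 + spinCoeff ε c 5 • monomialForm 0 2 +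
  spinCoeff ε c 6 • monomialForm 0 3 + spinCoeff ε c 7 • monomialForm 1 2 +
  spinCoeff ε c 8 • monomialForm 1 3 + spinCoeff ε c 9 • monomialForm 2 3

theorem spinForm_apply (ε : Bool) (c : Fin 20 → F) (x : Fin 4 → F) :
    spinForm ε c x = spinCoeff ε c 0 * (x 0 * x 0) + spinCoeff ε c 1 * (x 1 * x 1) +
      spinCoeff ε c 2 * (x 2 * x 2) + spinCoeff ε c 3 * (x 3 * x 3) +
      spinCoeff ε c 4 * (x 0 * x 1) + spinCoeff ε c 5 * (x 0 * x 2) +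
      spinCoeff ε c 6 * (x 0 * x 3) + spinCoeff ε c 7 * (x 1 * x 2) +
      spinCoeff ε c 8 * (x 1 * x 3) + spinCoeff ε c 9 * (x 2 * x 3) := rfl

theorem chart_true (x : Fin 4 → F) (i : Fin 4) : chart true x i =
    ![!![0, x 3, -x 2, 0, 0, x 0; -x 3, 0, x 1, 0, x 0, 0; x 2, -x 1, 0, x 0, 0, 0],
      !![0, 0, 0, -x 3, -x 2, -x 1; -x 3, 0, x 1, 0, x 0, 0; x 2, -x 1, 0, x 0, 0, 0],
      !![0, 0, 0, -x 3, -x 2, -x 1; 0, x 3, -x 2, 0, 0, x 0; x 2, -x 1, 0, x 0, 0, 0],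
      !![0, 0, 0, -x 3, -x 2, -x 1; 0, x 3, -x 2, 0, 0, x 0; -x 3, 0, x 1, 0, x 0, 0]] i := by
  ext r k
  change wedge true x (Pi.single (i.succAbove r) 1) k = _
  rw [wedge_true]
  fin_cases i <;> fin_cases r <;> fin_cases k <;> simp [Fin.succAbove]

theorem chart_false (x : Fin 4 → F) (i : Fin 4) : chart false x i =
    ![!![x 0, 0, 0, -x 2, x 3, 0; 0, x 0, 0, x 1, 0, -x 3; 0, 0, x 0, 0, -x 1, x 2],
      !![-x 1, -x 2, -x 3, 0, 0, 0; 0, x 0, 0, x 1, 0, -x 3; 0, 0, x 0, 0, -x 1, x 2],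
      !![-x 1, -x 2, -x 3, 0, 0, 0; x 0, 0, 0, -x 2, x 3, 0; 0, 0, x 0, 0, -x 1, x 2],
      !![-x 1, -x 2, -x 3, 0, 0, 0; x 0, 0, 0, -x 2, x 3, 0; 0, x 0, 0, x 1, 0, -x 3]] i := by
  ext r k
  change wedge false x (Pi.single (i.succAbove r) 1) k = _
  rw [wedge_false]
  fin_cases i <;> fin_cases r <;> fin_cases k <;> simp [Fin.succAbove]

set_option maxHeartbeats 1000000 in
theorem minorComb_chart_true (c : Fin 20 → F) (x : Fin 4 → F) (i : Fin 4) :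
    minorComb c (chart true x i) = (-1) ^ (i : ℕ) * x i * spinForm true c x := by
  rw [minorComb, sum_univ_twenty, spinForm_apply, chart_true]
  simp only [Matrix.det_fin_three, Matrix.submatrix_apply, id]
  fin_cases i <;> simp [triples, spinCoeff] <;> ring

set_option maxHeartbeats 1000000 in
theorem minorComb_chart_false (c : Fin 20 → F) (x : Fin 4 → F) (i : Fin 4) :
    minorComb c (chart false x i) = (-1) ^ (i : ℕ) * x i * spinForm false c x := by
  rw [minorComb, sum_univ_twenty, spinForm_apply, chart_false]
  simp only [Matrix.det_fin_three, Matrix.submatrix_apply, id]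
  fin_cases i <;> simp [triples, spinCoeff] <;> ring

/-- The minors are cubic in `x`, but in chart `i` they all share the factor `x i` up to sign. The
quadratic quotient is the same in all four charts, so it depends on the point and not on the chosen
basis. -/
theorem minorComb_chart (ε : Bool) (c : Fin 20 → F) (x : Fin 4 → F) (i : Fin 4) :
    minorComb c (chart ε x i) = (-1) ^ (i : ℕ) * x i * spinForm ε c x := by
  cases ε
  · exact minorComb_chart_false c x i
  · exact minorComb_chart_true c x i

/-- This provides a minor that does not vanish on chart `i` when `x i ≠ 0`, from which both the
independence of the chart rows and the invertibility of base changes follow. -/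
theorem exists_spinForm_eq_sq (ε : Bool) (i : Fin 4) :
    ∃ c : Fin 20 → F, ∀ x, spinForm ε c x = x i * x i := by
  cases ε
  · refine ⟨![Pi.single 0 1, -Pi.single 7 1, Pi.single 14 1, -Pi.single 18 1] i, fun x => ?_⟩
    fin_cases i <;> simp [spinForm_apply, spinCoeff]
  · refine ⟨![-Pi.single 19 1, Pi.single 12 1, -Pi.single 5 1, Pi.single 1 1] i, fun x => ?_⟩
    fin_cases i <;> simp [spinForm_apply, spinCoeff]

theorem exists_minorComb_chart_ne_zero (ε : Bool) {x : Fin 4 → F} {i : Fin 4} (hi : x i ≠ 0) :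
    ∃ c, minorComb c (chart ε x i) ≠ 0 := by
  obtain ⟨c, hc⟩ := exists_spinForm_eq_sq (F := F) ε i
  refine ⟨c, ?_⟩
  rw [minorComb_chart, hc]
  simp [hi]

theorem linearIndependent_chart (ε : Bool) {x : Fin 4 → F} {i : Fin 4} (hi : x i ≠ 0) :
    LinearIndependent F (chart ε x i).row := by
  obtain ⟨c, hc⟩ := exists_minorComb_chart_ne_zero ε hi
  obtain ⟨k, -, hk⟩ := Finset.exists_ne_zero_of_sum_ne_zero hc
  have h := Matrix.linearIndependent_rows_of_det_ne_zero (right_ne_zero_of_mul hk)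
  exact LinearIndependent.of_comp (LinearMap.funLeft F F (triples k)) h

theorem finrank_annih (ε : Bool) {x : Fin 4 → F} (hx : x ≠ 0) :
    Module.finrank F (annih ε x) = 3 := by
  obtain ⟨i, hi⟩ := Function.ne_iff.mp hx
  rw [annih_eq_span ε hi, finrank_span_eq_card (linearIndependent_chart ε hi)]
  simp

theorem quad_eq_zero_of_mem_annih {ε : Bool} {x : Fin 4 → F} (hx : x ≠ 0) {z : Fin (2 * 3) → F}
    (hz : z ∈ annih ε x) : quad z = 0 := by
  have h := halfSpin_mul_halfSpin_not (!ε) z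
  rw [Bool.not_not] at h
  have h' := congrArg (fun A => A.mulVec x) h
  simp only [← Matrix.mulVec_mulVec, mem_annih.mp hz, Matrix.mulVec_zero, Matrix.smul_mulVec,
    Matrix.one_mulVec] at h'
  rcases smul_eq_zero.mp h'.symm with h0 | h0
  · exact neg_eq_zero.mp h0
  · exact absurd h0 hx

theorem annih_mem_polarGrassmannian (ε : Bool) {x : Fin 4 → F} (hx : x ≠ 0) :
    annih ε x ∈ polarGrassmannian F 3 := by
  refine ⟨finrank_annih ε hx, fun v hv w hw => ⟨?_, quad_eq_zero_of_mem_annih hx hv⟩⟩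
  have h := quad_add v w
  rw [quad_eq_zero_of_mem_annih hx hv, quad_eq_zero_of_mem_annih hx hw,
    quad_eq_zero_of_mem_annih hx (add_mem hv hw)] at h
  simpa using h.symm

/-- The totally singular `3`-space annihilating a nonzero half-spinor. -/
def pureSpace (p : Bool × {x : Fin 4 → F // x ≠ 0}) : polarGrassmannian F 3 :=
  ⟨annih p.1 p.2, annih_mem_polarGrassmannian p.1 p.2.2⟩

theorem pureSpace_surjective : Function.Surjective (pureSpace (F := F)) := by
  rintro ⟨W, hW⟩
  obtain ⟨ε, x, hx, hle⟩ := exists_le_annih hW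
  refine ⟨(ε, ⟨x, hx⟩), Subtype.ext ?_⟩
  exact (Submodule.eq_of_le_of_finrank_eq hle (by rw [hW.1, finrank_annih ε hx])).symm

theorem annih_smul (ε : Bool) (x : Fin 4 → F) {a : F} (ha : a ≠ 0) :
    annih ε (a • x) = annih ε x := by
  ext z
  rw [mem_annih, mem_annih, Matrix.mulVec_smul, smul_eq_zero, or_iff_right ha]

/-- The inclusion says `x ∧ v ∧ y = 0` for every `v`; basis vectors `v` already force `x ∧ y = 0`.
-/
theorem minor_eq_zero_of_annih_le {ε : Bool} {x y : Fin 4 → F} (h : annih ε x ≤ annih ε y)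
    (i j : Fin 4) : x i * y j = x j * y i := by
  have key : ∀ k, wedge ε x (Pi.single k 1) ∈ annih ε y := fun k => h (wedge_mem_annih ε x _)
  have h0 := key 0
  have h1 := key 1
  have h2 := key 2
  have h3 := key 3
  cases ε
  · rw [mem_annih_false, wedge_false] at h0 h1 h2 h3
    simp at h0 h1 h2 h3
    fin_cases i <;> fin_cases j <;> simp <;> grind
  · rw [mem_annih_true, wedge_true] at h0 h1 h2 h3
    simp at h0 h1 h2 h3
    fin_cases i <;> fin_cases j <;> simp <;> grind

theorem exists_smul_of_annih_eq {ε : Bool} {x y : Fin 4 → F} (hx : x ≠ 0) (hy : y ≠ 0)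
    (h : annih ε x = annih ε y) : ∃ a : F, a ≠ 0 ∧ y = a • x := by
  obtain ⟨i, hi⟩ := Function.ne_iff.mp hx
  have e : y = (y i / x i) • x := by
    ext j
    have := minor_eq_zero_of_annih_le h.le i j
    rw [Pi.smul_apply, smul_eq_mul, div_mul_eq_mul_div, eq_div_iff hi]
    linear_combination this
  refine ⟨y i / x i, fun h0 => hy ?_, e⟩
  rw [e, h0, zero_smul]

/-- The two families are disjoint: equality would give `(v ⬝ᵥ y) • x = (x ⬝ᵥ y) • v` for all `v`,
and basis vectors `v` then force `y = 0`. -/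
theorem annih_ne_annih_not {ε : Bool} {x y : Fin 4 → F} (hx : x ≠ 0) (hy : y ≠ 0) :
    annih ε x ≠ annih (!ε) y := by
  intro h
  obtain ⟨i, hi⟩ := Function.ne_iff.mp hx
  have key : ∀ k, wedge ε x (Pi.single k 1) ∈ annih (!ε) y := fun k =>
    h ▸ wedge_mem_annih ε x _
  have h0 := key 0
  have h1 := key 1
  have h2 := key 2
  have h3 := key 3
  apply hy
  cases ε
  · rw [Bool.not_false, mem_annih_true, wedge_false] at h0 h1 h2 h3
    simp at h0 h1 h2 h3
    ext j
    fin_cases i <;> fin_cases j <;> simp at hi ⊢ <;> grind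
  · rw [Bool.not_true, mem_annih_false, wedge_true] at h0 h1 h2 h3
    simp at h0 h1 h2 h3
    ext j
    fin_cases i <;> fin_cases j <;> simp at hi ⊢ <;> grind

theorem pureSpace_eq_iff (p r : Bool × {x : Fin 4 → F // x ≠ 0}) :
    pureSpace p = pureSpace r ↔ p.1 = r.1 ∧ ∃ a : F, a ≠ 0 ∧ (r.2 : Fin 4 → F) = a • p.2.1 := by
  obtain ⟨ε, x, hx⟩ := p
  obtain ⟨δ, y, hy⟩ := r
  rw [pureSpace, pureSpace, Subtype.mk.injEq]
  constructor
  · intro h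
    have hεδ : ε = δ := by
      by_contra hne
      have : δ = !ε := by cases ε <;> cases δ <;> simp_all
      subst this
      exact annih_ne_annih_not hx hy h
    subst hεδ
    exact ⟨rfl, exists_smul_of_annih_eq hx hy h⟩
  · rintro ⟨h1, a, ha, h2⟩
    dsimp only at h1 h2 ⊢
    rw [h1, h2, annih_smul δ x ha]

/-- Any matrix representing `pureSpace p` has the minors given by the spin forms, up to a common
factor. -/
theorem exists_minorComb_eq {p : Bool × {x : Fin 4 → F // x ≠ 0}}
    {A : Matrix (Fin 3) (Fin (2 * 3)) F}
    (hA : Submodule.span F (Set.range A.row) = pureSpace p) :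
    ∃ a : F, a ≠ 0 ∧ ∀ c, minorComb c A = a * spinForm p.1 c p.2 := by
  obtain ⟨ε, x, hx⟩ := p
  obtain ⟨i, hi⟩ := Function.ne_iff.mp hx
  have hrow : ∀ r, ∃ g : Fin 3 → F, ∑ s, g s • A.row s = (chart ε x i).row r := by
    intro r
    have : (chart ε x i).row r ∈ Submodule.span F (Set.range A.row) := by
      rw [hA]
      exact wedge_mem_annih ε x _
    exact (Submodule.mem_span_range_iff_exists_fun F).mp this
  choose G hG using hrow
  have hmul : chart ε x i = Matrix.of G * A := by
    ext r k
    have := congrFun (hG r) k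
    rw [Matrix.mul_apply, ← Matrix.row_apply (chart ε x i), ← this]
    simp [Finset.sum_apply]
  have hdet : (Matrix.of G).det ≠ 0 := by
    obtain ⟨c, hc⟩ := exists_minorComb_chart_ne_zero ε hi
    rw [hmul, minorComb_mul] at hc
    exact left_ne_zero_of_mul hc
  refine ⟨(Matrix.of G).det⁻¹ * ((-1) ^ (i : ℕ) * x i), ?_, fun c => ?_⟩
  · exact mul_ne_zero (inv_ne_zero hdet)
      (mul_ne_zero (pow_ne_zero _ (neg_ne_zero.mpr one_ne_zero)) hi)
  · have h := minorComb_chart ε c x i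
    rw [hmul, minorComb_mul] at h
    rw [mul_assoc, ← h, inv_mul_cancel_left₀ hdet]

end Charts

/-! ### Codewords as pairs of quadratic forms. -/

section Code

variable {F : Type*} [Field F]

theorem ev_genericMinor {ι : Type*} {ℓ m : ℕ} (M : ι → Matrix (Fin ℓ) (Fin m) F)
    (I : Fin ℓ → Fin m) (W : ι) :
    ev M (genericMinor F I) W = ((M W).submatrix id I).det := by
  change MvPolynomial.aeval (fun p : Fin ℓ × Fin m => M W p.1 p.2) (genericMinor F I) = _
  rw [genericMinor, AlgHom.map_det]
  congr 1
  ext i j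
  simp [Matrix.mvPolynomialX]

theorem triples_strictMono (k : Fin 20) : StrictMono (triples k) := by
  have h : ∀ (k : Fin 20) (i j : Fin 3), i < j → triples k i < triples k j := by decide
  exact fun i j hij => h k i j hij

theorem exists_triples_eq {I : Fin 3 → Fin (2 * 3)} (hI : StrictMono I) :
    ∃ k, triples k = I := by
  have h : ∀ a b c : Fin (2 * 3), a < b → b < c →
      ∃ k, triples k 0 = a ∧ triples k 1 = b ∧ triples k 2 = c := by decide
  obtain ⟨k, h0, h1, h2⟩ := h (I 0) (I 1) (I 2) (hI (by decide)) (hI (by decide))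
  refine ⟨k, funext fun i => ?_⟩
  fin_cases i
  · exact h0
  · exact h1
  · exact h2

theorem minorSpace_eq :
    minorSpace F 3 (2 * 3) = Submodule.span F (Set.range fun k => genericMinor F (triples k)) := by
  rw [minorSpace]
  congr 1
  ext p
  constructor
  · rintro ⟨I, hI, rfl⟩
    obtain ⟨k, rfl⟩ := exists_triples_eq hI
    exact ⟨k, rfl⟩
  · rintro ⟨k, rfl⟩
    exact ⟨triples k, triples_strictMono k, rfl⟩

/-- The codeword of a linear combination of minors. -/
def word {ι : Type*} (M : ι → Matrix (Fin 3) (Fin (2 * 3)) F) : (Fin 20 → F) →ₗ[F] (ι → F) where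
  toFun c W := minorComb c (M W)
  map_add' a b := by
    ext W
    simp [minorComb, add_mul, Finset.sum_add_distrib]
  map_smul' a b := by
    ext W
    simp [minorComb, mul_assoc, Finset.mul_sum]

theorem word_apply {ι : Type*} (M : ι → Matrix (Fin 3) (Fin (2 * 3)) F) (c : Fin 20 → F) (W : ι) :
    word M c W = minorComb c (M W) := rfl

theorem word_single {ι : Type*} (M : ι → Matrix (Fin 3) (Fin (2 * 3)) F) (k : Fin 20) :
    word M (Pi.single k 1) = ev M (genericMinor F (triples k)) := by
  ext W
  rw [ev_genericMinor, word_apply, minorComb, Finset.sum_eq_single k]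
  · simp
  · intro j _ hj
    simp [hj]
  · simp

theorem polarCode_eq_range (M : polarGrassmannian F 3 → Matrix (Fin 3) (Fin (2 * 3)) F) :
    polarCode M = LinearMap.range (word M) := by
  rw [polarCode, minorSpace_eq, Submodule.map_span, ← Set.range_comp]
  ext v
  rw [Submodule.mem_span_range_iff_exists_fun, LinearMap.mem_range]
  refine exists_congr fun c => ?_
  have : word M c = ∑ k, c k • (ev M ∘ fun k => genericMinor F (triples k)) k := by
    ext W
    rw [Finset.sum_apply]
    simp [word_apply, minorComb, ev_genericMinor]
  rw [this]

/-- Values at basis vectors and at sums of two of them determine all coefficients, even over the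
field with two elements. -/
theorem spinCoeff_eq_zero {ε : Bool} {c : Fin 20 → F} (h : spinForm ε c = 0) (k : Fin 10) :
    spinCoeff ε c k = 0 := by
  have key : ∀ x : Fin 4 → F, spinForm ε c x = 0 := fun x => by rw [h]; rfl
  simp only [spinForm_apply] at key
  have h0 := key ![1, 0, 0, 0]
  have h1 := key ![0, 1, 0, 0]
  have h2 := key ![0, 0, 1, 0]
  have h3 := key ![0, 0, 0, 1]
  have h4 := key ![1, 1, 0, 0]
  have h5 := key ![1, 0, 1, 0]
  have h6 := key ![1, 0, 0, 1]
  have h7 := key ![0, 1, 1, 0]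
  have h8 := key ![0, 1, 0, 1]
  have h9 := key ![0, 0, 1, 1]
  clear key h
  generalize spinCoeff ε c = a at *
  simp at h0 h1 h2 h3
  simp [h0, h1, h2, h3] at h4 h5 h6 h7 h8 h9
  fin_cases k <;> assumption

/-- When `2 = 0`, the mixed coefficient of one form at a pair of indices equals that of the other
form at the complementary pair. If one form is zero, the other is therefore diagonal, and its polar
form is a multiple of 2. -/
theorem polar_spinForm_eq_zero (two : (2 : F) = 0) {ε : Bool} {c : Fin 20 → F}
    (h : spinForm (!ε) c = 0) (u v : Fin 4 → F) :
    QuadraticMap.polar (spinForm ε c) u v = 0 := by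
  have hc := spinCoeff_eq_zero h
  have h4 : spinCoeff ε c 4 = 0 ∧ spinCoeff ε c 5 = 0 ∧ spinCoeff ε c 6 = 0 ∧
      spinCoeff ε c 7 = 0 ∧ spinCoeff ε c 8 = 0 ∧ spinCoeff ε c 9 = 0 := by
    have c4 := hc 4
    have c5 := hc 5
    have c6 := hc 6
    have c7 := hc 7
    have c8 := hc 8
    have c9 := hc 9
    clear h hc
    cases ε <;> simp [spinCoeff] at c4 c5 c6 c7 c8 c9 ⊢ <;>
      refine ⟨?_, ?_, ?_, ?_, ?_, ?_⟩ <;> grind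
  obtain ⟨h4, h5, h6, h7, h8, h9⟩ := h4
  simp only [QuadraticMap.polar, spinForm_apply, Pi.add_apply, h4, h5, h6, h7, h8, h9]
  linear_combination (spinCoeff ε c 0 * u 0 * v 0 + spinCoeff ε c 1 * u 1 * v 1 +
    spinCoeff ε c 2 * u 2 * v 2 + spinCoeff ε c 3 * u 3 * v 3) * two

theorem word_ne_zero_iff {M : polarGrassmannian F 3 → Matrix (Fin 3) (Fin (2 * 3)) F}
    (hM : IsRepresentatives M) (c : Fin 20 → F) (p : Bool × {x : Fin 4 → F // x ≠ 0}) :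
    word M c (pureSpace p) ≠ 0 ↔ spinForm p.1 c p.2 ≠ 0 := by
  obtain ⟨a, ha, h⟩ := exists_minorComb_eq (hM (pureSpace p))
  rw [word_apply, h, mul_ne_zero_iff]
  exact and_iff_right ha

theorem word_eq_zero_iff {M : polarGrassmannian F 3 → Matrix (Fin 3) (Fin (2 * 3)) F}
    (hM : IsRepresentatives M) (c : Fin 20 → F) :
    word M c = 0 ↔ ∀ ε, spinForm ε c = 0 := by
  constructor
  · intro h ε
    ext x
    by_cases hx : x = 0
    · rw [hx, map_zero, map_zero]
    · have := (word_ne_zero_iff hM c (ε, ⟨x, hx⟩)).not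
      rw [not_not, not_not] at this
      exact this.mp (by rw [h]; rfl)
  · intro h
    ext W
    obtain ⟨p, rfl⟩ := pureSpace_surjective W
    by_contra hne
    apply (word_ne_zero_iff hM c p).mp hne
    rw [h]
    rfl

/-- The coordinates of the code in characteristic `2`. -/
def evenCoordinates : (Fin 20 → F) →ₗ[F] (Fin 14 → F) where
  toFun c := ![c 0, c 7, c 14, c 18, c 19, c 12, c 5, c 1, c 15 + c 17, c 9 + c 16, c 8 + c 13,
    c 6 + c 11, c 3 + c 10, c 2 + c 4]
  map_add' a b := by
    ext k
    fin_cases k <;> simp <;> ring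
  map_smul' a b := by
    ext k
    fin_cases k <;> simp <;> ring

theorem evenCoordinates_surjective : Function.Surjective (evenCoordinates (F := F)) := by
  intro d
  refine ⟨![d 0, d 7, d 13, d 12, 0, d 6, d 11, d 1, d 10, d 9, 0, 0, d 5, 0, d 2, d 8, 0, 0,
    d 3, d 4], ?_⟩
  ext k
  fin_cases k <;> simp [evenCoordinates]

theorem evenCoordinates_eq_zero_iff (two : (2 : F) = 0) (c : Fin 20 → F) :
    evenCoordinates c = 0 ↔ ∀ ε, spinForm ε c = 0 := by
  have expand : evenCoordinates c = 0 ↔ (c 0 = 0 ∧ c 7 = 0 ∧ c 14 = 0 ∧ c 18 = 0 ∧ c 19 = 0 ∧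
      c 12 = 0 ∧ c 5 = 0 ∧ c 1 = 0 ∧ c 15 + c 17 = 0 ∧ c 9 + c 16 = 0 ∧ c 8 + c 13 = 0 ∧
      c 6 + c 11 = 0 ∧ c 3 + c 10 = 0 ∧ c 2 + c 4 = 0) := by
    simp [funext_iff, Fin.forall_fin_succ, evenCoordinates]
  rw [expand]
  constructor
  · rintro ⟨h0, h7, h14, h18, h19, h12, h5, h1, h8, h9, h10, h11, h13, h2⟩ ε
    ext x
    rw [spinForm_apply]
    have hc : ∀ k, spinCoeff ε c k = 0 := by
      intro k
      cases ε <;> fin_cases k <;> simp [spinCoeff] <;> grind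
    simp [hc]
  · intro h
    have ht := spinCoeff_eq_zero (h true)
    have hf := spinCoeff_eq_zero (h false)
    simp [Fin.forall_fin_succ, spinCoeff] at ht hf
    grind

/-- Here `word M` and `evenCoordinates` have the same kernel, hence the same rank, and the latter is
onto a 14-dimensional space. -/
theorem finrank_polarCode (two : (2 : F) = 0)
    {M : polarGrassmannian F 3 → Matrix (Fin 3) (Fin (2 * 3)) F} (hM : IsRepresentatives M) :
    Module.finrank F (polarCode M) = 14 := by
  have hker : LinearMap.ker (word M) = LinearMap.ker (evenCoordinates (F := F)) := by
    ext c
    rw [LinearMap.mem_ker, LinearMap.mem_ker, word_eq_zero_iff hM,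
      evenCoordinates_eq_zero_iff two]
  have h1 := LinearMap.finrank_range_add_finrank_ker (word M)
  have h2 := LinearMap.finrank_range_add_finrank_ker (evenCoordinates (F := F))
  rw [LinearMap.range_eq_top.mpr evenCoordinates_surjective, finrank_top, ← hker, ← h1] at h2
  rw [polarCode_eq_range]
  have h3 := Nat.add_right_cancel h2
  rw [← h3]
  simp

theorem word_hyperbolic {ι : Type*} (M : ι → Matrix (Fin 3) (Fin (2 * 3)) F) :
    word M (Pi.single 12 1 + Pi.single 19 1) =
      ev M (genericMinor F ![1, 2, 5] + genericMinor F ![3, 4, 5]) := by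
  rw [map_add, map_add, word_single, word_single]
  rfl

theorem card_sub_one_pos [Fintype F] : 0 < Fintype.card F - 1 :=
  Nat.sub_pos_of_lt Fintype.one_lt_card

theorem isMinDist_of_weights [DecidableEq F] {ι : Type*} [Fintype ι] {C : Submodule F (ι → F)} {d : ℕ}
    (hd : 0 < d) (hle : ∀ v ∈ C, v ≠ 0 → d ≤ hammingNorm v) {v : ι → F} (hv : v ∈ C)
    (hvd : hammingNorm v = d) : IsMinDist C d := by
  constructor
  · refine ⟨v, hv, 0, C.zero_mem, ?_, ?_⟩
    · rintro rfl
      rw [hammingNorm_zero] at hvd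
      omega
    · rw [hammingDist_zero_right, hvd]
  · rintro _ ⟨a, ha, b, hb, hab, rfl⟩
    rw [hammingDist_eq_hammingNorm]
    exact hle _ (by exact C.add_mem (C.neg_mem ha) hb) (by simpa [neg_add_eq_zero] using hab)

/-! ### Weights, and the number of singular 3-spaces. -/

variable [Fintype F] [DecidableEq F]

theorem card_fiber_pureSpace [DecidableEq (polarGrassmannian F 3)] (W : polarGrassmannian F 3) :
    #{p : Bool × {x : Fin 4 → F // x ≠ 0} | pureSpace p = W} = Fintype.card F - 1 := by
  obtain ⟨⟨ε, x, hx⟩, rfl⟩ := pureSpace_surjective W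
  rw [← card_univ, ← card_erase_of_mem (mem_univ (0 : F))]
  symm
  refine card_bij (fun a ha => (ε, ⟨a • x, smul_ne_zero (ne_of_mem_erase ha) hx⟩)) ?_ ?_ ?_
  · intro a ha
    rw [mem_filter, eq_comm, pureSpace_eq_iff]
    exact ⟨mem_univ _, rfl, a, ne_of_mem_erase ha, rfl⟩
  · intro a ha b hb h
    have h' : a • x = b • x := congrArg (fun p => (p.2 : Fin 4 → F)) h
    exact smul_left_injective F hx h'
  · rintro ⟨δ, y, hy⟩ h
    rw [mem_filter, eq_comm, pureSpace_eq_iff] at h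
    obtain ⟨-, h1, a, ha, h2⟩ := h
    refine ⟨a, mem_erase.mpr ⟨ha, mem_univ a⟩, ?_⟩
    dsimp only at h1 h2
    subst h1
    subst h2
    rfl

theorem card_pureSpace_preimage (P : polarGrassmannian F 3 → Prop) [DecidablePred P] :
    #{p : Bool × {x : Fin 4 → F // x ≠ 0} | P (pureSpace p)} =
      (Fintype.card F - 1) * #{W | P W} := by
  classical
  rw [card_eq_sum_card_fiberwise (f := pureSpace) (t := ({W | P W} : Finset _))
    (fun p hp => by simpa using hp), mul_comm (_ - 1)]
  refine sum_const_nat fun W hW => Eq.trans ?_ (card_fiber_pureSpace W)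
  rw [filter_filter]
  congr 1
  ext p
  simp only [mem_filter, mem_univ, true_and] at hW ⊢
  exact ⟨fun h => h.2, fun h => ⟨h ▸ hW, h⟩⟩

theorem card_polarGrassmannian :
    (Fintype.card F - 1) * Fintype.card (polarGrassmannian F 3) =
      2 * (Fintype.card F ^ 4 - 1) := by
  have h := card_pureSpace_preimage (F := F) (fun _ => True)
  simp only [filter_true, card_univ] at h
  rw [← h, Fintype.card_prod, Fintype.card_bool]
  congr 1
  rw [Fintype.card_subtype_compl, Fintype.card_subtype_eq, Fintype.card_fun, Fintype.card_fin]

/-- The weight of a codeword counts the nonzeros of its two quadratic forms. -/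
theorem hammingNorm_word {M : polarGrassmannian F 3 → Matrix (Fin 3) (Fin (2 * 3)) F}
    (hM : IsRepresentatives M) (c : Fin 20 → F) :
    (Fintype.card F - 1) * hammingNorm (word M c) =
      #{x | spinForm true c x ≠ 0} + #{x | spinForm false c x ≠ 0} := by
  have h := card_pureSpace_preimage (fun W => word M c W ≠ 0)
  rw [hammingNorm, ← h]
  simp only [word_ne_zero_iff hM]
  -- The zero spinor is never a nonzero of the form, so admitting it does not change the count.
  have hsub : ∀ ε, #{x : {x : Fin 4 → F // x ≠ 0} | spinForm ε c x ≠ 0} =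
      #{x | spinForm ε c x ≠ 0} := by
    intro ε
    refine card_bij (fun x _ => x.1) ?_ ?_ ?_
    · intro x hx
      simpa using hx
    · intro x _ y _ hxy
      exact Subtype.ext hxy
    · intro x hx
      rw [mem_filter] at hx
      refine ⟨⟨x, fun h0 => hx.2 (by rw [h0, map_zero])⟩, ?_, rfl⟩
      simpa using hx.2
  rw [← hsub, ← hsub]
  simp only [card_filter]
  rw [Fintype.sum_prod_type, Fintype.sum_bool]

theorem card_nonzero_spinForm_ge {ε : Bool} {c : Fin 20 → F} (h : spinForm ε c ≠ 0) :
    Fintype.card F ^ 2 * (Fintype.card F - 1) ^ 2 ≤ #{x | spinForm ε c x ≠ 0} := by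
  have h1 := card_nonzero_ge (spinForm ε c) h
  rw [Fintype.card_fun, Fintype.card_fin] at h1
  have hq : 0 < Fintype.card F ^ 2 := pow_pos Fintype.card_pos 2
  refine Nat.le_of_mul_le_mul_left ?_ hq
  calc _ = Fintype.card F ^ 4 * (Fintype.card F - 1) ^ 2 := by ring
    _ ≤ _ := h1

theorem card_nonzero_spinForm_ge_of_additive (two : (2 : F) = 0) {ε : Bool} {c : Fin 20 → F}
    (h : spinForm ε c ≠ 0) (h' : spinForm (!ε) c = 0) :
    Fintype.card F ^ 3 * (Fintype.card F - 1) ≤ #{x | spinForm ε c x ≠ 0} := by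
  have h1 := card_nonzero_of_orthogonal (spinForm ε c) h
    fun u v _ _ => polar_spinForm_eq_zero two h' u v
  rw [Fintype.card_fun, Fintype.card_fin] at h1
  refine Nat.le_of_mul_le_mul_left ?_ (Fintype.card_pos (α := F))
  calc _ = Fintype.card F ^ 4 * (Fintype.card F - 1) := by ring
    _ ≤ _ := h1

theorem hammingNorm_word_ge {M : polarGrassmannian F 3 → Matrix (Fin 3) (Fin (2 * 3)) F}
    (hM : IsRepresentatives M) {c : Fin 20 → F} (hc : word M c ≠ 0) :
    Fintype.card F ^ 3 - Fintype.card F ^ 2 ≤ hammingNorm (word M c) := by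
  have hw := hammingNorm_word hM c
  have hq := card_sub_one_pos (F := F)
  refine Nat.le_of_mul_le_mul_left ?_ hq
  have e : (Fintype.card F - 1) * (Fintype.card F ^ 3 - Fintype.card F ^ 2) =
      Fintype.card F ^ 2 * (Fintype.card F - 1) ^ 2 := by
    rw [pow_succ _ 2, ← Nat.mul_sub_one]
    ring
  rw [e, hw]
  rw [Ne, word_eq_zero_iff hM, not_forall] at hc
  obtain ⟨ε, hε⟩ := hc
  have := card_nonzero_spinForm_ge hε
  cases ε <;> omega

theorem hammingNorm_word_ge_of_even (two : (2 : F) = 0)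
    {M : polarGrassmannian F 3 → Matrix (Fin 3) (Fin (2 * 3)) F}
    (hM : IsRepresentatives M) {c : Fin 20 → F} (hc : word M c ≠ 0) :
    Fintype.card F ^ 3 ≤ hammingNorm (word M c) := by
  have hw := hammingNorm_word hM c
  have hq := card_sub_one_pos (F := F)
  refine Nat.le_of_mul_le_mul_left ?_ hq
  rw [hw]
  rw [Ne, word_eq_zero_iff hM, not_forall] at hc
  obtain ⟨ε, hε⟩ := hc
  by_cases h' : spinForm (!ε) c = 0
  · have := card_nonzero_spinForm_ge_of_additive two hε h'
    rw [mul_comm] at this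
    cases ε <;> omega
  · have h1 := card_nonzero_spinForm_ge hε
    have h2 := card_nonzero_spinForm_ge h'
    have h3 : (Fintype.card F - 1) * Fintype.card F ^ 3 ≤
        2 * (Fintype.card F ^ 2 * (Fintype.card F - 1) ^ 2) := by
      -- This is `2 ≤ q`; it lets two hyperbolic bounds together reach `q ^ 3`.
      have : Fintype.card F ≤ 2 * (Fintype.card F - 1) := by omega
      calc (Fintype.card F - 1) * Fintype.card F ^ 3
          = (Fintype.card F - 1) * Fintype.card F ^ 2 * Fintype.card F := by ring
        _ ≤ (Fintype.card F - 1) * Fintype.card F ^ 2 * (2 * (Fintype.card F - 1)) :=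
            Nat.mul_le_mul_left _ this
        _ = _ := by ring
    cases ε <;> simp only [Bool.not_true, Bool.not_false] at h2 <;> omega

theorem hammingNorm_word_hyperbolic (two : (2 : F) ≠ 0)
    {M : polarGrassmannian F 3 → Matrix (Fin 3) (Fin (2 * 3)) F} (hM : IsRepresentatives M) :
    hammingNorm (word M (Pi.single 12 1 + Pi.single 19 1)) =
      Fintype.card F ^ 3 - Fintype.card F ^ 2 := by
  have ht : ∀ x, spinForm true (Pi.single 12 1 + Pi.single 19 1 : Fin 20 → F) x =
      (x 1 - x 0) * (x 1 + x 0) := by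
    intro x
    simp [spinForm_apply, spinCoeff]
    ring
  have hf : ∀ x, spinForm false (Pi.single 12 1 + Pi.single 19 1 : Fin 20 → F) x = 0 := by
    intro x
    simp [spinForm_apply, spinCoeff]
  have hw := hammingNorm_word hM (Pi.single 12 1 + Pi.single 19 1)
  simp only [ht, hf, ne_eq, not_true, filter_false, card_empty, add_zero] at hw
  -- Only an upper bound is needed, since the general lower bound matches it. The two linear factors
  -- serve as new coordinates, and recovering `x 0` from them requires `2 ≠ 0`.
  have hle : #{x : Fin 4 → F | ¬(x 1 - x 0) * (x 1 + x 0) = 0} ≤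
      Fintype.card F ^ 2 * (Fintype.card F - 1) ^ 2 := by
    have hcard : #(Fintype.piFinset ![univ.erase (0 : F), univ.erase 0, univ, univ]) =
        Fintype.card F ^ 2 * (Fintype.card F - 1) ^ 2 := by
      rw [Fintype.card_piFinset, Fin.prod_univ_four]
      simp [card_erase_of_mem]
      ring
    rw [← hcard]
    refine card_le_card_of_injOn (fun x => ![x 1 - x 0, x 1 + x 0, x 2, x 3]) ?_ ?_
    · intro x hx
      simpa [Fintype.mem_piFinset, Fin.forall_fin_succ] using hx
    · intro x _ y _ hxy
      have h0 : x 1 - x 0 = y 1 - y 0 := congrFun hxy 0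
      have h1 : x 1 + x 0 = y 1 + y 0 := congrFun hxy 1
      have h2 : x 2 = y 2 := congrFun hxy 2
      have h3 : x 3 = y 3 := congrFun hxy 3
      have e0 : x 0 = y 0 := mul_left_cancel₀ two (by linear_combination h1 - h0)
      have e1 : x 1 = y 1 := by linear_combination h1 - e0
      ext j
      fin_cases j
      · exact e0
      · exact e1
      · exact h2
      · exact h3
  have hne : word M (Pi.single 12 1 + Pi.single 19 1) ≠ 0 := by
    rw [Ne, word_eq_zero_iff hM]
    intro h
    have := ht ![0, 1, 0, 0]
    rw [h] at this
    simp at this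
  refine le_antisymm ?_ (hammingNorm_word_ge hM hne)
  refine Nat.le_of_mul_le_mul_left ?_ (card_sub_one_pos (F := F))
  rw [hw]
  refine hle.trans_eq ?_
  rw [pow_succ _ 2, ← Nat.mul_sub_one]
  ring

/-- The forms are `-(x 0) ^ 2` and zero, so the support is one copy of PG(3, q) minus a plane, in
every characteristic. -/
theorem hammingNorm_word_single
    {M : polarGrassmannian F 3 → Matrix (Fin 3) (Fin (2 * 3)) F} (hM : IsRepresentatives M) :
    hammingNorm (word M (Pi.single 19 1)) = Fintype.card F ^ 3 := by
  have ht : ∀ x, spinForm true (Pi.single 19 1 : Fin 20 → F) x = -(x 0 * x 0) := by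
    intro x
    simp [spinForm_apply, spinCoeff]
  have hf : ∀ x, spinForm false (Pi.single 19 1 : Fin 20 → F) x = 0 := by
    intro x
    simp [spinForm_apply, spinCoeff]
  have hw := hammingNorm_word hM (Pi.single 19 1)
  simp only [ht, hf, ne_eq, not_true, filter_false, card_empty, add_zero] at hw
  have hcard : #{x : Fin 4 → F | ¬-(x 0 * x 0) = 0} =
      (Fintype.card F - 1) * Fintype.card F ^ 3 := by
    have : ({x : Fin 4 → F | ¬-(x 0 * x 0) = 0} : Finset _) =
        Fintype.piFinset ![univ.erase (0 : F), univ, univ, univ] := by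
      ext x
      simp [Fintype.mem_piFinset, Fin.forall_fin_succ]
    rw [this, Fintype.card_piFinset, Fin.prod_univ_four]
    simp [card_erase_of_mem]
    ring
  rw [hcard] at hw
  exact Nat.eq_of_mul_eq_mul_left (card_sub_one_pos (F := F)) hw

end Code

end OrthogonalGrassmann

/-! ### Assembly by the parity of `q`. -/

open OrthogonalGrassmann in
theorem mainTheorem1 (F : Type*) [Field F] [Fintype F] [DecidableEq F] (q : ℕ)
    (hq : Fintype.card F = q)
    (M : OrthogonalGrassmann.polarGrassmannian F 3 → Matrix (Fin 3) (Fin (2 * 3)) F)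
    (hM : OrthogonalGrassmann.IsRepresentatives M) :
    (Odd q →
      OrthogonalGrassmann.IsMinDist (OrthogonalGrassmann.polarCode M) (q ^ 3 - q ^ 2) ∧
      OrthogonalGrassmann.ev M (OrthogonalGrassmann.genericMinor F ![1, 2, 5] +
        OrthogonalGrassmann.genericMinor F ![3, 4, 5]) ∈ OrthogonalGrassmann.polarCode M ∧
      hammingNorm (OrthogonalGrassmann.ev M (OrthogonalGrassmann.genericMinor F ![1, 2, 5] +
        OrthogonalGrassmann.genericMinor F ![3, 4, 5])) = q ^ 3 - q ^ 2) ∧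
    (Even q →
      OrthogonalGrassmann.IsMinDist (OrthogonalGrassmann.polarCode M) (q ^ 3) ∧
      OrthogonalGrassmann.ev M (OrthogonalGrassmann.genericMinor F ![3, 4, 5]) ∈
        OrthogonalGrassmann.polarCode M ∧
      hammingNorm (OrthogonalGrassmann.ev M (OrthogonalGrassmann.genericMinor F ![3, 4, 5])) =
        q ^ 3) ∧
    (q = 2 →
      Fintype.card (OrthogonalGrassmann.polarGrassmannian F 3) = 30 ∧
      Module.finrank F (OrthogonalGrassmann.polarCode M) = 14 ∧
      OrthogonalGrassmann.IsMinDist (OrthogonalGrassmann.polarCode M) 8) := by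
  subst hq
  have hone : 1 < Fintype.card F := Fintype.one_lt_card
  have htwo : Even (Fintype.card F) → (2 : F) = 0 := by
    intro he
    have h1 : ringChar F = 2 :=
      FiniteField.even_card_iff_char_two.mpr (Nat.even_iff.mp he)
    have h2 := ringChar.Nat.cast_ringChar (R := F)
    rw [h1] at h2
    exact_mod_cast h2
  have htwo' : Odd (Fintype.card F) → (2 : F) ≠ 0 := by
    intro ho
    exact Ring.two_ne_zero fun h => by
      have h1 := FiniteField.even_card_iff_char_two.mp h
      rw [Nat.odd_iff] at ho
      omega
  have heven : Even (Fintype.card F) →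
      IsMinDist (polarCode M) (Fintype.card F ^ 3) ∧
      ev M (genericMinor F ![3, 4, 5]) ∈ polarCode M ∧
      hammingNorm (ev M (genericMinor F ![3, 4, 5])) = Fintype.card F ^ 3 := by
    intro he
    have two := htwo he
    have hev : ev M (genericMinor F ![3, 4, 5]) = word M (Pi.single 19 1) :=
      (word_single M 19).symm
    have hmem : word M (Pi.single 19 1) ∈ polarCode M := by
      rw [polarCode_eq_range]
      exact ⟨_, rfl⟩
    rw [hev]
    refine ⟨isMinDist_of_weights (by positivity) ?_ hmem (hammingNorm_word_single hM), hmem,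
      hammingNorm_word_single hM⟩
    intro v hv hne
    rw [polarCode_eq_range] at hv
    obtain ⟨c, rfl⟩ := hv
    exact hammingNorm_word_ge_of_even two hM hne
  refine ⟨fun ho => ?_, heven, fun h2 => ?_⟩
  · have two := htwo' ho
    rw [← word_hyperbolic]
    have hmem : word M (Pi.single 12 1 + Pi.single 19 1) ∈ polarCode M := by
      rw [polarCode_eq_range]
      exact ⟨_, rfl⟩
    refine ⟨isMinDist_of_weights (Nat.sub_pos_of_lt (Nat.pow_lt_pow_right hone (by norm_num))) ?_
      hmem (hammingNorm_word_hyperbolic two hM), hmem, hammingNorm_word_hyperbolic two hM⟩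
    intro v hv hne
    rw [polarCode_eq_range] at hv
    obtain ⟨c, rfl⟩ := hv
    exact hammingNorm_word_ge hM hne
  · have he : Even (Fintype.card F) := by rw [h2]; exact even_two
    refine ⟨?_, finrank_polarCode (htwo he) hM, ?_⟩
    -- For `q = 2` the count reads `1 * n = 2 * (2 ^ 4 - 1)`.
    · have h := card_polarGrassmannian (F := F)
      rw [h2] at h
      omega
    · have h := (heven he).1
      rw [h2] at h
      exact h
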